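/- Let $n\ge 1$ and let $J\subseteq \mathbb{Z}_{2n+1}\setminus\{0\}$ satisfy $|J|=n$ and $|\{j,-j\}\cap J|=1$ for every $j\in J$. Let $\overrightarrow{C}_{2n+1}(J)$ be the circulant tournament with vertex set $\mathbb{Z}_{2n+1}$ in which $(i,j)$ is an arc if and only if $j-i\in J$. For digraphs $D$ and $F$, the composition $D[F]$ has vertex set $V(D)\times V(F)$, with an arc from $(v,x)$ to $(w,y)$ if and only if $(v,w)$ is an arc of $D$, or $v=w$ and $(x,y)$ is an arc of $F$. A digraph is simple if it is not isomorphic to a composition $D[F]$ of two digraphs $D$ and $F$ with at least two vertices each. For a finite digraph $D$, let $\overrightarrow{\omega}_3(D)$ be the maximum number of connected components of the underlying graph of $D\setminus A(D^*)$, where $D^*$ runs over the subdigraphs of $D$ containing no directed triangle. A partition of $V(D)$ into nonempty classes is externally $\overrightarrow{C}_3$-free if the arcs of $D$ that join different classes form a subdigraph containing no directed triangle; such a partition is optimal if it has exactly $\overrightarrow{\omega}_3(D)$ classes. A class is singular if it has exactly one element. The digraph $D$ is $\overrightarrow{\omega}_3$-keen if some optimal externally $\overrightarrow{C}_3$-free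 partition of $V(D)$ has exactly one singular class and no externally $\overrightarrow{C}_3$-free partition of $V(D)$ has more than one singular class. If $\overrightarrow{C}_{2n+1}(J)$ is simple, then it is $\overrightarrow{\omega}_3$-keen. -/

import Mathlib

/-- A digraph contains no directed triangle `u → v → w → u`. -/
def Digraph.IsTriangleFree {V : Type*} (D : Digraph V) : Prop :=
  ¬ ∃ u v w : V, u ≠ v ∧ v ≠ w ∧ w ≠ u ∧ D.Adj u v ∧ D.Adj v w ∧ D.Adj w u

/-- The directed triangle free disconnection `ω₃(D)` of a finite digraph `D`: the maximum number
of connected components of the underlying graph of `D ∖ A(D*)`, where `D*` runs over the directed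
triangle free subdigraphs of `D`. Only the arcs of `D*` matter, so spanning subdigraphs suffice. -/
noncomputable def Digraph.omega3 {V : Type*} (D : Digraph V) : ℕ :=
  sSup {k : ℕ | ∃ H : Digraph V, H ≤ D ∧ H.IsTriangleFree ∧
    k = Nat.card (D \ H).toSimpleGraphInclusive.ConnectedComponent}

/-- The digraph of the external arcs of `D` with respect to a partition of its vertex set, given
as an equivalence relation: the arcs joining different classes. -/
def Digraph.externalArcs {V : Type*} (D : Digraph V) (π : Setoid V) : Digraph V where
  Adj u v := D.Adj u v ∧ ¬ π u v

/-- An externally `C₃`-free partition: its external arcs induce no directed triangle. -/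
def Digraph.IsExternallyTriangleFree {V : Type*} (D : Digraph V) (π : Setoid V) : Prop :=
  (D.externalArcs π).IsTriangleFree

/-- An externally `C₃`-free partition is optimal if it has exactly `ω₃(D)` classes. -/
def Digraph.IsOptimalTriangleFree {V : Type*} (D : Digraph V) (π : Setoid V) : Prop :=
  D.IsExternallyTriangleFree π ∧ π.classes.ncard = D.omega3

/-- The singular classes of a partition: those consisting of a single element. -/
def Setoid.singularClasses {V : Type*} (π : Setoid V) : Set (Set V) :=
  {C | C ∈ π.classes ∧ C.ncard = 1}

/-- A finite digraph is `ω₃`-keen if some optimal externally `C₃`-free partition has exactly one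
singular class and no externally `C₃`-free partition has more than one. -/
def Digraph.IsOmega3Keen {V : Type*} (D : Digraph V) : Prop :=
  (∃ π : Setoid V, D.IsOptimalTriangleFree π ∧ π.singularClasses.ncard = 1) ∧
    ∀ π : Setoid V, D.IsExternallyTriangleFree π → π.singularClasses.ncard ≤ 1

/-- The composition (lexicographic product) `D[F]`: every vertex of `D` is replaced by a copy
of `F`. -/
def Digraph.composition {V W : Type*} (D : Digraph V) (F : Digraph W) : Digraph (V × W) where
  Adj x y := D.Adj x.1 y.1 ∨ (x.1 = y.1 ∧ F.Adj x.2 y.2)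

/-- A digraph is simple (prime) if it is not isomorphic to a composition of two digraphs with at
least two vertices each. (The factors embed into the digraph, so its universe suffices.) -/
def Digraph.IsSimple.{u} {V : Type u} (D : Digraph V) : Prop :=
  ∀ (X Y : Type u) (E : Digraph X) (F : Digraph Y), Nontrivial X → Nontrivial Y →
    IsEmpty (D.Adj ≃r (E.composition F).Adj)

/-- `J` is the symbol set of a circulant tournament of order `2 * n + 1`. -/
structure IsSymbolSet (n : ℕ) (J : Finset (ZMod (2 * n + 1))) : Prop where
  zero_notMem : 0 ∉ J
  card_eq : J.card = n
  card_pair : ∀ j ∈ J, (({j, -j} : Finset (ZMod (2 * n + 1))) ∩ J).card = 1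

/-- The circulant tournament with symbol set `J`: `(i, j)` is an arc if and only if
`j - i ∈ J`. -/
def circulantTournament (n : ℕ) (J : Finset (ZMod (2 * n + 1))) :
    Digraph (ZMod (2 * n + 1)) where
  Adj i j := j - i ∈ J

/-! The tournament has order 2|J| + 1, and each vertex has |J| out-neighbours and |J| in-neighbours.
Regularity puts every arc in a directed triangle, so two singular classes would leave an external
triangle. It remains to show that `omega3` is 2, since then the partition into {0} and its
complement is optimal. This amounts to excluding surjective 3-colourings without a rainbow directed
triangle (`not_isRainbowFree`).

The engine is the isoperimetric inequality `DomBound`. Intersecting the first components of two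
dominating pairs and uniting the second ones, or conversely, gives dominating pairs again with the
same combined size. Uncrossing translates in this way turns a violation of the bound into a proper
nontrivial subgroup whose cosets are modules, hence into a composition, which simplicity forbids
(`domBound_of_isSimple`).

Given the bound, a Vosper-type study of equality shows that no colour class of a rainbow-free
colouring is a singleton (`IsRainbowFree.two_le_card_filter`). On the other hand, a minimal set
closed under in-arcs between colours misses a colour (`IsRainbowFree.exists_initial`). Applying this
twice, the second time after deleting the vertices that dominate all other colours, yields two
dominating pairs whose bounds add up to a contradiction. -/

/-- A subset `J` of an additive group such that `x → y ↔ y - x ∈ J` is a tournament. -/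
structure IsTournamentSet {G : Type*} [AddCommGroup G] (J : Finset G) : Prop where
  zero_notMem : 0 ∉ J
  mem_of_neg_notMem : ∀ x : G, x ≠ 0 → -x ∉ J → x ∈ J
  neg_notMem : ∀ x ∈ J, -x ∉ J

theorem IsTournamentSet.sub_mem_or {G : Type*} [AddCommGroup G] {J : Finset G}
    (hJ : IsTournamentSet J) {x y : G} (h : x ≠ y) :
    y - x ∈ J ∨ x - y ∈ J := by
  by_cases h1 : x - y ∈ J
  · exact Or.inr h1
  · refine Or.inl (hJ.mem_of_neg_notMem _ (sub_ne_zero.2 h.symm) ?_)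
    rwa [neg_sub]

theorem IsTournamentSet.not_sub_mem {G : Type*} [AddCommGroup G] {J : Finset G}
    (hJ : IsTournamentSet J) {x y : G} (h : y - x ∈ J) :
    x - y ∉ J := by
  have := hJ.neg_notMem _ h
  rwa [neg_sub] at this

/-- Every vertex of `U` dominates every vertex of `W` in the Cayley digraph of `J`. -/
def Dom {G : Type*} [AddCommGroup G] (J U W : Finset G) : Prop :=
  ∀ u ∈ U, ∀ w ∈ W, w - u ∈ J

/-- Two nonempty sets, the first dominating the second, have at most `|J| + 1` elements in total. -/
def DomBound {G : Type*} [AddCommGroup G] (J : Finset G) : Prop :=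
  ∀ U W : Finset G, U.Nonempty → W.Nonempty → Dom J U W → U.card + W.card ≤ J.card + 1

/-! ### Dominating pairs, uncrossing, and the subgroup behind a violated bound. -/

section Translates

open Finset Pointwise

variable {G : Type*} [AddCommGroup G] [DecidableEq G] {J : Finset G}

theorem mem_vadd_finset_iff_sub (g x : G) (U : Finset G) : x ∈ g +ᵥ U ↔ x - g ∈ U := by
  rw [Finset.mem_vadd_finset]
  constructor
  · rintro ⟨y, hy, rfl⟩
    simpa using hy
  · intro h
    exact ⟨x - g, h, by simp⟩

theorem Dom.vadd {U W : Finset G} (h : Dom J U W) (g : G) : Dom J (g +ᵥ U) (g +ᵥ W) := by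
  intro u hu w hw
  rw [mem_vadd_finset_iff_sub] at hu hw
  simpa using h _ hu _ hw

theorem Dom.neg {U W : Finset G} (h : Dom J U W) : Dom J (-W) (-U) := by
  intro u hu w hw
  rw [Finset.mem_neg'] at hu hw
  simpa [sub_eq_add_neg, add_comm] using h _ hw _ hu

theorem Dom.inter_union {U W U' W' : Finset G} (h : Dom J U W) (h' : Dom J U' W') :
    Dom J (U ∩ U') (W ∪ W') := by
  intro u hu w hw
  rw [mem_inter] at hu
  rcases mem_union.1 hw with hw | hw
  · exact h u hu.1 w hw
  · exact h' u hu.2 w hw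

theorem Dom.union_inter {U W U' W' : Finset G} (h : Dom J U W) (h' : Dom J U' W') :
    Dom J (U ∪ U') (W ∩ W') := by
  intro u hu w hw
  rw [mem_inter] at hw
  rcases mem_union.1 hu with hu | hu
  · exact h u hu w hw.1
  · exact h' u hu w hw.2

theorem Dom.card_le {U W : Finset G} (h : Dom J U W) (hU : U.Nonempty) : W.card ≤ J.card := by
  obtain ⟨u, hu⟩ := hU
  have : (-u) +ᵥ W ⊆ J := by
    intro x hx
    rw [mem_vadd_finset_iff_sub] at hx
    simpa using h u hu _ hx
  simpa using card_le_card this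

theorem IsTournamentSet.card_eq [Fintype G] (hJ : IsTournamentSet J) :
    Fintype.card G = 2 * J.card + 1 := by
  have h1 : (univ : Finset G) = insert 0 (J ∪ -J) := by
    ext x
    simp only [mem_univ, mem_insert, mem_union, Finset.mem_neg', true_iff]
    by_cases h0 : x = 0
    · exact Or.inl h0
    · by_cases h : -x ∈ J
      · exact Or.inr (Or.inr h)
      · exact Or.inr (Or.inl (hJ.mem_of_neg_notMem x h0 h))
  have h2 : Disjoint J (-J) := by
    rw [Finset.disjoint_left]
    intro x hx hx'
    exact hJ.neg_notMem x hx (Finset.mem_neg'.1 hx')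
  rw [← Finset.card_univ, h1, card_insert_of_notMem, card_union_of_disjoint h2, card_neg]
  · ring
  · simp [hJ.zero_notMem]

/-- If the domination bound fails, then some proper nontrivial subgroup is a module. -/
theorem exists_addSubgroup_of_not_domBound [Fintype G] (hJ : IsTournamentSet J)
    (hb : ¬ DomBound J) :
    ∃ H : AddSubgroup G, H ≠ ⊥ ∧ H ≠ ⊤ ∧ ∀ x ∈ J, x ∉ H → ∀ h ∈ H, x + h ∈ J := by
  classical
  -- pairs of maximal total size
  let S : Finset (Finset G × Finset G) :=
    univ.filter fun p => p.1.Nonempty ∧ p.2.Nonempty ∧ Dom J p.1 p.2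
  have hS : ∀ p, p ∈ S ↔ p.1.Nonempty ∧ p.2.Nonempty ∧ Dom J p.1 p.2 := by
    intro p
    simp [S]
  unfold DomBound at hb
  push Not at hb
  obtain ⟨U₀, W₀, hU₀, hW₀, hd₀, hc₀⟩ := hb
  obtain ⟨M, hMS, hM⟩ := S.exists_max_image (fun p => p.1.card + p.2.card)
    ⟨(U₀, W₀), (hS _).2 ⟨hU₀, hW₀, hd₀⟩⟩
  let S' := S.filter fun p => p.1.card + p.2.card = M.1.card + M.2.card
  have hS' : ∀ p, p ∈ S' ↔ p ∈ S ∧ p.1.card + p.2.card = M.1.card + M.2.card := by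
    intro p
    simp [S']
  -- The smallest first component plays the role of an atom: its translates coincide or are disjoint
  -- (`htrans`), so it is a coset of its stabiliser `H`.
  obtain ⟨⟨U, W⟩, hUW, hmin⟩ := S'.exists_min_image (fun p => p.1.card)
    ⟨M, (hS' _).2 ⟨hMS, rfl⟩⟩
  obtain ⟨hUWS, hcard⟩ := (hS' _).1 hUW
  obtain ⟨hU, hW, hd⟩ := (hS _).1 hUWS
  simp only at hcard hU hW hd
  set σ := M.1.card + M.2.card with hσ
  have hσJ : J.card + 2 ≤ σ := by
    have := hM (U₀, W₀) ((hS _).2 ⟨hU₀, hW₀, hd₀⟩)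
    simp only at this
    omega
  have hmax : ∀ A B : Finset G, A.Nonempty → B.Nonempty → Dom J A B → A.card + B.card ≤ σ :=
    fun A B hA hB h => hM (A, B) ((hS _).2 ⟨hA, hB, h⟩)
  have hmin' : ∀ A B : Finset G, A.Nonempty → B.Nonempty → Dom J A B → A.card + B.card = σ →
      U.card ≤ A.card :=
    fun A B hA hB h hc => hmin (A, B) ((hS' _).2 ⟨(hS _).2 ⟨hA, hB, h⟩, hc⟩)
  -- Negation exchanges the two components of a pair. The inequality is what makes `W` meet its
  -- translate in `htrans`.
  have hUleW : U.card ≤ W.card := by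
    have := hmin' (-W) (-U) hW.neg hU.neg hd.neg (by simp only [card_neg]; omega)
    simpa using this
  have htrans : ∀ g : G, (U ∩ (g +ᵥ U)).Nonempty → g +ᵥ U = U := by
    intro g hg
    have hci := card_union_add_card_inter U (g +ᵥ U)
    have hcw := card_union_add_card_inter W (g +ᵥ W)
    rw [card_vadd_finset] at hci hcw
    have hWW : (W ∪ (g +ᵥ W)).Nonempty := hW.mono subset_union_left
    have hUU : (U ∪ (g +ᵥ U)).Nonempty := hU.mono subset_union_left
    have h1 := hmax _ _ hg hWW (hd.inter_union (hd.vadd g))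
    have hpos := hg.card_pos
    have hne : (W ∩ (g +ᵥ W)).Nonempty := by
      rw [← card_pos]
      omega
    have h2 := hmax _ _ hUU hne (hd.union_inter (hd.vadd g))
    have h3 := hmin' _ _ hg hWW (hd.inter_union (hd.vadd g)) (by omega)
    have h4 : U ∩ (g +ᵥ U) = U := eq_of_subset_of_card_le inter_subset_left h3
    exact (eq_of_subset_of_card_le (inter_eq_left.1 h4) (by simp)).symm
  obtain ⟨u₀, hu₀⟩ := hU
  have hmemH : ∀ {g : G}, u₀ + g ∈ U → g +ᵥ U = U := fun {g} hg =>
    htrans g ⟨u₀ + g, mem_inter.2 ⟨hg, by rw [mem_vadd_finset_iff_sub]; simpa using hu₀⟩⟩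
  let H : AddSubgroup G :=
    { carrier := {g | g +ᵥ U = U}
      zero_mem' := by simp
      add_mem' := by
        intro a b ha hb
        simp only [Set.mem_ofPred_eq] at *
        rw [add_vadd, hb, ha]
      neg_mem' := by
        intro a ha
        simp only [Set.mem_ofPred_eq] at *
        nth_rewrite 1 [← ha]
        simp }
  have hH : ∀ g, g ∈ H ↔ u₀ + g ∈ U := by
    intro g
    refine ⟨fun h => ?_, fun h => hmemH h⟩
    have h : g +ᵥ U = U := h
    rw [← h, mem_vadd_finset_iff_sub]
    simpa using hu₀
  have hcardH : (univ.filter fun x => x ∈ H).card = U.card := by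
    rw [← card_vadd_finset u₀]
    congr 1
    ext x
    rw [mem_vadd_finset_iff_sub]
    simp [hH]
  have hU' : U.Nonempty := ⟨u₀, hu₀⟩
  have hWJ := hd.card_le hU'
  -- out-neighbours of `H`
  let Z : Finset G := (-u₀) +ᵥ W
  have hZc : Z.card = W.card := card_vadd_finset _ _
  have hZ : ∀ z ∈ Z, ∀ h ∈ H, z - h ∈ J := by
    intro z hz h hh
    have h1 : z + u₀ ∈ W := by
      have := (mem_vadd_finset_iff_sub _ _ _).1 hz
      simpa using this
    have := hd _ ((hH h).1 hh) _ h1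
    convert this using 1
    abel
  have hZmax : ∀ z, (∀ h ∈ H, z - h ∈ J) → z ∈ Z := by
    intro z hz
    by_contra hzZ
    have hd' : Dom J (univ.filter fun x => x ∈ H) (insert z Z) := by
      intro h hh w hw
      have hh : h ∈ H := by simpa using hh
      rcases mem_insert.1 hw with rfl | hw
      · exact hz h hh
      · exact hZ w hw h hh
    have := hmax _ _ ⟨0, by simp⟩ ⟨z, mem_insert_self _ _⟩ hd'
    rw [card_insert_of_notMem hzZ] at this
    omega
  have hZadd : ∀ z ∈ Z, ∀ h ∈ H, z + h ∈ Z := by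
    intro z hz h hh
    apply hZmax
    intro k hk
    have := hZ z hz (k - h) (H.sub_mem hk hh)
    convert this using 1
    abel
  have hZH : ∀ z ∈ Z, z ∉ H := by
    intro z hz hzH
    have := hZ z hz z hzH
    rw [sub_self] at this
    exact hJ.zero_notMem this
  have hZJ : ∀ z ∈ Z, z ∈ J := fun z hz => by simpa using hZ z hz 0 H.zero_mem
  -- Otherwise `H`, `Z`, `-Z` and `x + H` are disjoint, with 2(|U| + |W|) ≥ 2|J| + 4 elements in
  -- all, more than the group has. Hence `J` outside `H` is exactly the `H`-periodic set `Z`.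
  have hcover : ∀ x, x ∉ H → x ∉ Z → -x ∈ Z := by
    intro x hxH hxZ
    by_contra hx
    have hsub : Disjoint ((univ.filter fun y => y ∈ H) ∪ (Z ∪ -Z)) 
        (x +ᵥ (univ.filter fun y => y ∈ H)) := by
      rw [Finset.disjoint_left]
      intro y hy hy'
      rw [mem_vadd_finset_iff_sub] at hy'
      simp only [mem_filter, mem_univ, true_and] at hy'
      simp only [mem_union, mem_filter, mem_univ, true_and, Finset.mem_neg'] at hy
      rcases hy with hy | hy | hy
      · exact hxH (by simpa using H.sub_mem hy hy')
      · exact hxZ (by simpa using hZadd y hy _ (H.neg_mem hy'))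
      · have := hZadd _ hy _ hy'
        exact hx (by convert this using 1; abel)
    have hd1 : Disjoint Z (-Z) := by
      rw [Finset.disjoint_left]
      intro z hz hz'
      exact hJ.neg_notMem z (hZJ z hz) (hZJ _ (Finset.mem_neg'.1 hz'))
    have hd2 : Disjoint (univ.filter fun y => y ∈ H) (Z ∪ -Z) := by
      rw [Finset.disjoint_left]
      intro z hz hz'
      have hz : z ∈ H := by simpa using hz
      rcases mem_union.1 hz' with h | h
      · exact hZH z h hz
      · exact hZH _ (Finset.mem_neg'.1 h) (H.neg_mem hz)
    have h1 := card_le_univ (((univ.filter fun y => y ∈ H) ∪ (Z ∪ -Z)) ∪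
      (x +ᵥ (univ.filter fun y => y ∈ H)))
    rw [card_union_of_disjoint hsub, card_union_of_disjoint hd2, card_union_of_disjoint hd1,
      card_vadd_finset x, card_neg, hJ.card_eq] at h1
    omega
  refine ⟨H, ?_, ?_, ?_⟩
  · rintro hbot
    have : (univ.filter fun x => x ∈ H).card ≤ 1 := by
      rw [hbot, card_le_one]
      simp
    omega
  · rintro htop
    obtain ⟨w, hw⟩ := hW
    have : -u₀ +ᵥ w ∈ Z := vadd_mem_vadd_finset hw
    exact hZH _ this (by rw [htop]; trivial)
  · intro x hx hxH h hh
    by_cases hxZ : x ∈ Z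
    · exact hZJ _ (hZadd x hxZ h hh)
    · exact absurd (hZJ _ (hcover x hxH hxZ)) (hJ.neg_notMem x hx)

end Translates

/-! ### Pairs attaining the bound. -/

section Extremal

open Finset Pointwise

variable {G : Type*} [AddCommGroup G] [DecidableEq G] {J : Finset G}

/-- The domination bound is attained by the pair `(U, W)`. -/
structure IsExtremal (J U W : Finset G) : Prop where
  left_nonempty : U.Nonempty
  right_nonempty : W.Nonempty
  dom : Dom J U W
  card_add : U.card + W.card = J.card + 1

theorem IsExtremal.vadd {U W : Finset G} (h : IsExtremal J U W) (g : G) :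
    IsExtremal J (g +ᵥ U) (g +ᵥ W) where
  left_nonempty := h.1.vadd_finset
  right_nonempty := h.2.vadd_finset
  dom := h.3.vadd g
  card_add := by simpa using h.4

/-- The two new pairs have total size 2(|J| + 1), so neither can fall short of its bound. -/
theorem IsExtremal.uncross (hb : DomBound J) {U W U' W' : Finset G} (h : IsExtremal J U W)
    (h' : IsExtremal J U' W') (hU : (U ∩ U').Nonempty) (hW : (W ∩ W').Nonempty) :
    IsExtremal J (U ∩ U') (W ∪ W') ∧ IsExtremal J (U ∪ U') (W ∩ W') := by
  have hW2 : (W ∪ W').Nonempty := h.2.mono subset_union_left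
  have hU2 : (U ∪ U').Nonempty := h.1.mono subset_union_left
  have hd1 := h.3.inter_union h'.3
  have hd2 := h.3.union_inter h'.3
  have h1 := hb _ _ hU hW2 hd1
  have h2 := hb _ _ hU2 hW hd2
  have h3 := card_union_add_card_inter U U'
  have h4 := card_union_add_card_inter W W'
  have h5 := h.4
  have h6 := h'.4
  exact ⟨⟨hU, hW2, hd1, by omega⟩, ⟨hU2, hW, hd2, by omega⟩⟩

theorem card_nsmul_eq_zero_of_vadd_eq {U : Finset G} {g : G} (h : g +ᵥ U = U) :
    U.card • g = 0 := by
  have h1 : ∑ x ∈ g +ᵥ U, x = ∑ x ∈ U, (g + x) :=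
    sum_image (fun x _ y _ hxy => by simpa using hxy)
  rw [h, sum_add_distrib, sum_const] at h1
  simpa using h1

/-- A period of `U` is a period of `W` by maximality, so |U| + |W| = |J| + 1 annihilates it. So does
the group order 2|J| + 1, and this is coprime to |J| + 1. -/
theorem IsExtremal.eq_zero_of_vadd_eq [Fintype G] (hJ : IsTournamentSet J) (hb : DomBound J)
    {U W : Finset G} (h : IsExtremal J U W) {g : G} (hg : g +ᵥ U = U) : g = 0 := by
  have hd : Dom J U (W ∪ (g +ᵥ W)) := by
    have := h.3.inter_union (h.3.vadd g)
    rwa [hg, inter_self] at this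
  have h1 := hb _ _ h.1 (h.2.mono subset_union_left) hd
  have h2 : W ∪ (g +ᵥ W) = W :=
    (eq_of_subset_of_card_le subset_union_left (by have := h.4; omega)).symm
  have h3 : g +ᵥ W = W := eq_of_subset_of_card_le (union_eq_left.1 h2) (by simp)
  have h4 := card_nsmul_eq_zero_of_vadd_eq hg
  have h5 := card_nsmul_eq_zero_of_vadd_eq h3
  have h6 : (J.card + 1) • g = 0 := by rw [← h.4, add_smul, h4, h5, add_zero]
  have h7 : (2 * J.card + 1) • g = 0 := by rw [← hJ.card_eq, card_nsmul_eq_zero]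
  have h8 : (2 * (J.card + 1)) • g = (2 * J.card + 1) • g + g := by
    rw [← succ_nsmul]
    congr 1
  rw [mul_smul, h6, h7] at h8
  simpa using h8.symm

/-- An extremal pair whose first component is small can be shrunk to one whose first component
has two elements. -/
theorem IsExtremal.exists_card_two [Fintype G] (hJ : IsTournamentSet J) (hb : DomBound J)
    {U₀ W₀ : Finset G} (h₀ : IsExtremal J U₀ W₀) (h2 : 2 ≤ U₀.card)
    (hsmall : U₀.card = 2 ∨ 2 * U₀.card ≤ J.card) :
    ∃ U W : Finset G, IsExtremal J U W ∧ U.card = 2 := by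
  classical
  let S : Finset (Finset G × Finset G) := univ.filter fun p => IsExtremal J p.1 p.2 ∧ 2 ≤ p.1.card
  have hS : ∀ p, p ∈ S ↔ IsExtremal J p.1 p.2 ∧ 2 ≤ p.1.card := by
    intro p
    simp [S]
  obtain ⟨⟨U, W⟩, hUW, hmin⟩ := S.exists_min_image (fun p => p.1.card)
    ⟨(U₀, W₀), (hS _).2 ⟨h₀, h2⟩⟩
  obtain ⟨hE, hU2⟩ := (hS _).1 hUW
  simp only at hE hU2
  have hmin' : ∀ A B : Finset G, IsExtremal J A B → 2 ≤ A.card → U.card ≤ A.card :=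
    fun A B h hA => hmin (A, B) ((hS _).2 ⟨h, hA⟩)
  refine ⟨U, W, hE, ?_⟩
  by_contra hne
  have hU3 : 3 ≤ U.card := by omega
  have hUn : 2 * U.card ≤ J.card := by
    have := hmin' _ _ h₀ h2
    omega
  have hUW' := hE.4
  -- two translates that share a point dominate a common point
  have hmeet : ∀ a b : G, ((a +ᵥ U) ∩ (b +ᵥ U)).Nonempty → ((a +ᵥ W) ∩ (b +ᵥ W)).Nonempty := by
    intro a b hab
    have h1 := ((hE.vadd a).3.inter_union (hE.vadd b).3).card_le hab
    have h2 := card_union_add_card_inter (a +ᵥ W) (b +ᵥ W)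
    rw [card_vadd_finset, card_vadd_finset] at h2
    rw [← card_pos]
    omega
  have hone : ∀ a b : G, a ≠ b → ((a +ᵥ U) ∩ (b +ᵥ U)).card ≤ 1 := by
    intro a b hab
    by_contra hlt
    have hne : ((a +ᵥ U) ∩ (b +ᵥ U)).Nonempty := by
      rw [← card_pos]
      omega
    have h1 := (hE.vadd a).uncross hb (hE.vadd b) hne (hmeet a b hne)
    have h2 := hmin' _ _ h1.1 (by omega)
    have h3 : (a +ᵥ U) ∩ (b +ᵥ U) = a +ᵥ U :=
      eq_of_subset_of_card_le inter_subset_left (by simpa using h2)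
    have h4 : a +ᵥ U = b +ᵥ U :=
      eq_of_subset_of_card_le (inter_eq_left.1 h3) (by simp)
    have h5 : (a - b) +ᵥ U = U := by
      rw [sub_eq_neg_add, add_vadd, h4, neg_vadd_vadd]
    exact hab (sub_eq_zero.1 (hE.eq_zero_of_vadd_eq hJ hb h5))
  obtain ⟨x, y, z, hx, hy, hz, hxy, hxz, hyz⟩ := two_lt_card_iff.1 hU3
  have h0 : ∀ a ∈ U, (0 : G) ∈ (-a) +ᵥ U := by
    intro a ha
    rw [mem_vadd_finset_iff_sub]
    simpa using ha
  have hpair : ∀ a ∈ U, ∀ b ∈ U, a ≠ b →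
      IsExtremal J (((-a) +ᵥ U) ∪ ((-b) +ᵥ U)) (((-a) +ᵥ W) ∩ ((-b) +ᵥ W)) ∧
      ((-a) +ᵥ W) ∪ ((-b) +ᵥ W) = J ∧
      (((-a) +ᵥ W) ∩ ((-b) +ᵥ W)).card + 2 * U.card = J.card + 2 := by
    intro a ha b hb' hab
    have hne : (((-a) +ᵥ U) ∩ ((-b) +ᵥ U)).Nonempty := ⟨0, mem_inter.2 ⟨h0 a ha, h0 b hb'⟩⟩
    have h1 := (hE.vadd (-a)).uncross hb (hE.vadd (-b)) hne (hmeet _ _ hne)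
    have h2 := hone (-a) (-b) (by simpa using hab)
    have h3 := hne.card_pos
    have h4 := h1.1.4
    have h5 := card_union_add_card_inter ((-a) +ᵥ W) ((-b) +ᵥ W)
    rw [card_vadd_finset, card_vadd_finset] at h5
    refine ⟨h1.2, ?_, by omega⟩
    apply eq_of_subset_of_card_le
    · intro w hw
      simpa using h1.1.3 0 (mem_inter.2 ⟨h0 a ha, h0 b hb'⟩) w hw
    · omega
  have hF := hpair y hy z hz hyz
  have hyx := hpair y hy x hx hxy.symm
  have hzx := hpair z hz x hx hxz.symm
  -- The set `(W_y ∩ W_z) ∪ W_x` is all of `J`, where `W_a` stands for `-a + W`; the sizes of its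
  -- two parts are known.
  have hbound : 3 * U.card ≤ J.card + 3 := by
    have h1 : (((-y) +ᵥ W) ∩ ((-z) +ᵥ W)) ∪ ((-x) +ᵥ W) = J := by
      rw [inter_union_distrib_right, hyx.2.1, hzx.2.1, inter_self]
    have h2 := card_union_le (((-y) +ᵥ W) ∩ ((-z) +ᵥ W)) ((-x) +ᵥ W)
    rw [h1, card_vadd_finset] at h2
    omega
  -- This shift sends `z` to `x - y` and `y` to `x - z`, which lie in `-y + U` and `-z + U`.
  -- Uncrossing with the union of those translates gives an extremal first component with at least 2
  -- points, hence at least |U| ≥ 3. By `hone` it has at most 1 + 1 points.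
  have hE' := hE.vadd (x - y - z)
  have hm1 : x - y ∈ ((x - y - z) +ᵥ U) ∩ (((-y) +ᵥ U) ∪ ((-z) +ᵥ U)) := by
    simp only [mem_inter, mem_union, mem_vadd_finset_iff_sub]
    refine ⟨?_, Or.inl ?_⟩
    · simpa using hz
    · convert hx using 1
      abel
  have hm2 : x - z ∈ ((x - y - z) +ᵥ U) ∩ (((-y) +ᵥ U) ∪ ((-z) +ᵥ U)) := by
    simp only [mem_inter, mem_union, mem_vadd_finset_iff_sub]
    refine ⟨?_, Or.inr ?_⟩
    · convert hy using 1
      abel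
    · convert hx using 1
      abel
  have hc2 : 2 ≤ (((x - y - z) +ᵥ U) ∩ (((-y) +ᵥ U) ∪ ((-z) +ᵥ U))).card :=
    one_lt_card.2 ⟨_, hm1, _, hm2, by simpa using hyz⟩
  have hWmeet : (((x - y - z) +ᵥ W) ∩ (((-y) +ᵥ W) ∩ ((-z) +ᵥ W))).Nonempty := by
    have h1 := hb _ _ ⟨_, hm1⟩ (hE'.2.mono subset_union_left) (hE'.3.inter_union hF.1.3)
    have h2 := card_union_add_card_inter ((x - y - z) +ᵥ W) (((-y) +ᵥ W) ∩ ((-z) +ᵥ W))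
    rw [card_vadd_finset] at h2
    rw [← card_pos]
    omega
  have h1 := hmin' _ _ (hE'.uncross hb hF.1 ⟨_, hm1⟩ hWmeet).1 hc2
  have h3 := hone (x - y - z) (-y) (by
    intro h
    apply hxz
    have : x - z = (x - y - z) - (-y) := by abel
    rw [h, sub_self] at this
    exact sub_eq_zero.1 this)
  have h4 := hone (x - y - z) (-z) (by
    intro h
    apply hxy
    have : x - y = (x - y - z) - (-z) := by abel
    rw [h, sub_self] at this
    exact sub_eq_zero.1 this)
  rw [inter_union_distrib_left] at h1
  have h5 := card_union_le (((x - y - z) +ᵥ U) ∩ ((-y) +ᵥ U)) (((x - y - z) +ᵥ U) ∩ ((-z) +ᵥ U))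
  omega

end Extremal

/-! ### The two-element case: `J` is nearly invariant under a shift. -/

section Progression

open Finset Pointwise

variable {G : Type*} [AddCommGroup G] [DecidableEq G] {J : Finset G}

/-- If the subgroup `K` generated by `d` were proper, it would dominate `J \ K`, so |K| ≤ |J ∩ K| +
1. But `K` contains 0 and `-d` besides `J ∩ K`. -/
theorem zmultiples_eq_top_of_sub_mem [Fintype G] (hJ : IsTournamentSet J) (hb : DomBound J)
    {d j₀ : G} (hd : d ∈ J) (h : ∀ j ∈ J, j ≠ j₀ → j - d ∈ J) :
    AddSubgroup.zmultiples d = ⊤ := by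
  classical
  set K := AddSubgroup.zmultiples d with hK
  have hnat : ∀ x ∈ K, ∃ m : ℕ, m • d = x := fun x hx =>
    AddSubmonoid.mem_multiples_iff _ _ |>.1
      ((isOfFinAddOrder_of_finite d).mem_multiples_iff_mem_zmultiples.2 hx)
  have hdK : d ∈ K := AddSubgroup.mem_zmultiples d
  have hj₀ : j₀ ∈ K := by
    by_contra hj
    have : ∀ m : ℕ, d - m • d ∈ J := by
      intro m
      induction m with
      | zero => simpa using hd
      | succ m ih =>
        have := h _ ih (by
          rintro rfl
          exact hj (K.sub_mem hdK (K.nsmul_mem hdK m)))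
        rwa [succ_nsmul, ← sub_sub]
    have h1 := this 1
    simp only [one_smul, sub_self] at h1
    exact hJ.zero_notMem h1
  by_contra hne
  obtain ⟨x, hx⟩ : ∃ x, x ∉ K := by
    by_contra! hall
    exact hne (by ext x; simp [hall x])
  have hclosed : ∀ j ∈ J, j ∉ K → ∀ m : ℕ, j - m • d ∈ J := by
    intro j hj hjK m
    induction m with
    | zero => simpa using hj
    | succ m ih =>
      have := h _ ih (by
        intro heq
        apply hjK
        rw [← heq] at hj₀
        have := K.add_mem hj₀ (K.nsmul_mem hdK m)
        simpa using this)
      rwa [succ_nsmul, ← sub_sub]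
  have hdom : Dom J (univ.filter fun y => y ∈ K) (J.filter fun y => y ∉ K) := by
    intro u hu w hw
    simp only [mem_filter, mem_univ, true_and] at hu hw
    obtain ⟨m, rfl⟩ := hnat u hu
    exact hclosed w hw.1 hw.2 m
  have hne2 : (J.filter fun y => y ∉ K).Nonempty := by
    have hx0 : x ≠ 0 := fun h => hx (h ▸ K.zero_mem)
    by_cases hxJ : -x ∈ J
    · exact ⟨-x, by simpa using ⟨hxJ, hx⟩⟩
    · exact ⟨x, by simpa using ⟨hJ.mem_of_neg_notMem x hx0 hxJ, hx⟩⟩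
  have h1 := hb _ _ ⟨0, by simp⟩ hne2 hdom
  have h2 := card_filter_add_card_filter_not (s := J) (fun y => y ∈ K)
  have hd0 : d ≠ 0 := fun h => hJ.zero_notMem (h ▸ hd)
  have h3 : insert 0 (insert (-d) (J.filter fun y => y ∈ K)) ⊆ univ.filter fun y => y ∈ K := by
    intro y hy
    simp only [mem_insert, mem_filter] at hy
    rcases hy with rfl | rfl | hy
    · simp
    · simpa using hdK
    · simpa using hy.2
  have h4 := card_le_card h3
  rw [card_insert_of_notMem, card_insert_of_notMem] at h4
  · omega
  · simp [hJ.neg_notMem d hd]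
  · simp [hJ.zero_notMem, hd0]

/-- A tournament set with an extremal pair whose first component has two elements has an element
that, added to any element, leaves the set. -/
theorem IsExtremal.exists_add_notMem [Fintype G] (hJ : IsTournamentSet J) (hb : DomBound J)
    {U W : Finset G} (hE : IsExtremal J U W) (hU : U.card = 2) :
    ∃ e ∈ J, ∀ j ∈ J, -(e + j) ∈ J := by
  classical
  obtain ⟨a, b, hab, haU, hbU, hdJ⟩ : ∃ a b, a ≠ b ∧ a ∈ U ∧ b ∈ U ∧ b - a ∈ J := by
    obtain ⟨a, b, hab, rfl⟩ := card_eq_two.1 hU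
    rcases hJ.sub_mem_or hab with h | h
    · exact ⟨a, b, hab, by simp, by simp, h⟩
    · exact ⟨b, a, hab.symm, by simp, by simp, h⟩
  set d := b - a with hd
  have hZJ : (-a) +ᵥ W ⊆ J := by
    intro w hw
    rw [mem_vadd_finset_iff_sub] at hw
    simpa using hE.3 a haU _ hw
  have hZd : ∀ w ∈ (-a) +ᵥ W, w - d ∈ J := by
    intro w hw
    rw [mem_vadd_finset_iff_sub] at hw
    have := hE.3 b hbU _ hw
    convert this using 1
    rw [hd]
    abel
  have hone : (J \ ((-a) +ᵥ W)).card = 1 := by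
    rw [card_sdiff_of_subset hZJ, card_vadd_finset]
    have h1 := hE.4
    omega
  obtain ⟨j₀, hj₀⟩ := card_eq_one.1 hone
  have hstep₀ : ∀ j ∈ J, j ≠ j₀ → j - d ∈ J := by
    intro j hj hne
    by_cases hjZ : j ∈ (-a) +ᵥ W
    · exact hZd j hjZ
    · exact absurd (mem_singleton.1 (hj₀ ▸ mem_sdiff.2 ⟨hj, hjZ⟩)) hne
  -- The only exceptional element is `d` itself, because `d - d = 0` is not in `J`.
  have hstep : ∀ j ∈ J, j ≠ d → j - d ∈ J := by
    intro j hj hne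
    apply hstep₀ j hj
    rintro rfl
    have := hstep₀ d hdJ hne.symm
    rw [sub_self] at this
    exact hJ.zero_notMem this
  have htop := zmultiples_eq_top_of_sub_mem hJ hb hdJ hstep₀
  have hnat : ∀ x : G, ∃ m : ℕ, m • d = x := fun x =>
    AddSubmonoid.mem_multiples_iff _ _ |>.1
      ((isOfFinAddOrder_of_finite d).mem_multiples_iff_mem_zmultiples.2 (by rw [htop]; trivial))
  obtain ⟨e, heJ, hed⟩ : ∃ e ∈ J, e + d ∉ J := by
    by_contra! hall
    have : ∀ m : ℕ, d + m • d ∈ J := by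
      intro m
      induction m with
      | zero => simpa using hdJ
      | succ m ih =>
        rw [succ_nsmul, ← add_assoc]
        exact hall _ ih
    obtain ⟨m, hm⟩ := hnat (-d)
    have := this m
    rw [hm, add_neg_cancel] at this
    exact hJ.zero_notMem this
  -- If `m • d` and `e + m • d` were both in `J`, subtracting `d` from both would descend to `e + d
  -- ∈ J` or `0 ∈ J`.
  have hmain : ∀ m : ℕ, m • d ∈ J → e + m • d ∉ J := by
    intro m
    induction m with
    | zero =>
      intro h
      rw [zero_nsmul] at h
      exact absurd h hJ.zero_notMem
    | succ m ih =>
      intro hm hem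
      by_cases hmd : (m + 1) • d = d
      · rw [hmd] at hem
        exact hed hem
      · have h1 := hstep _ hm hmd
        rw [succ_nsmul, add_sub_cancel_right] at h1
        apply ih h1
        have h2 := hstep _ hem (by
          intro h
          rw [succ_nsmul, ← add_assoc, add_eq_right] at h
          rw [← neg_eq_of_add_eq_zero_right h] at h1
          exact hJ.neg_notMem _ heJ h1)
        rwa [succ_nsmul, ← add_assoc, add_sub_cancel_right] at h2
  refine ⟨e, heJ, fun j hj => ?_⟩
  obtain ⟨m, rfl⟩ := hnat j
  apply hJ.mem_of_neg_notMem
  · rw [neg_ne_zero]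
    intro h
    rw [← neg_eq_of_add_eq_zero_right h] at hj
    exact hJ.neg_notMem _ heJ hj
  · rw [neg_neg]
    exact hmain m hj

end Progression

/-! ### Rainbow-free 3-colourings. -/

section Colorings

open Finset Pointwise

variable {G : Type*} [AddCommGroup G] {J : Finset G}

/-- A surjective colouring with three colours none of whose directed triangles is rainbow. -/
structure IsRainbowFree (J : Finset G) (col : G → Fin 3) : Prop where
  surjective : Function.Surjective col
  not_cyclic : ∀ u v w, col u ≠ col v → col v ≠ col w → col w ≠ col u →
    v - u ∈ J → w - v ∈ J → u - w ∉ J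

theorem IsRainbowFree.trans (hJ : IsTournamentSet J) {col : G → Fin 3} (hc : IsRainbowFree J col)
    {u v w : G} (huv : col u ≠ col v) (hvw : col v ≠ col w) (hwu : col w ≠ col u)
    (h1 : v - u ∈ J) (h2 : w - v ∈ J) : w - u ∈ J :=
  (hJ.sub_mem_or (x := u) (y := w) (fun h => hwu (h ▸ rfl))).resolve_right
    (hc.not_cyclic u v w huv hvw hwu h1 h2)

variable [Fintype G] [DecidableEq G]

theorem card_filter_add_three {α : Type*} [Fintype α] (col : α → Fin 3) {i j k : Fin 3}
    (hij : i ≠ j) (hik : i ≠ k) (hjk : j ≠ k) :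
    (univ.filter fun x => col x = i).card + (univ.filter fun x => col x = j).card +
      (univ.filter fun x => col x = k).card = Fintype.card α := by
  classical
  rw [← card_union_of_disjoint, ← card_union_of_disjoint, ← card_univ]
  · congr 1
    ext x
    simp only [mem_union, mem_filter, mem_univ, true_and, iff_true]
    omega
  · rw [Finset.disjoint_left]
    intro x
    simp only [mem_union, mem_filter, mem_univ, true_and]
    omega
  · rw [Finset.disjoint_left]
    intro x
    simp only [mem_filter, mem_univ, true_and]
    omega

/-- A vertex `c` forming a class of its own cannot split two further nonempty classes into the parts
`Am`, `Bm` before `c` and `Ap`, `Bp` after `c` without creating a rainbow triangle. -/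
theorem false_of_singular_aux (hJ : IsTournamentSet J) (hb : DomBound J) {c : G}
    {Am Ap Bm Bp : Finset G} (hdA : Disjoint Am Bm) (hdB : Disjoint Ap Bp)
    (hm : ∀ x, x ∈ Am ∪ Bm ↔ c - x ∈ J) (hp : ∀ x, x ∈ Ap ∪ Bp ↔ x - c ∈ J)
    (hAB : Dom J Am Bp) (hBA : Dom J Bm Ap) (hA : Am.Nonempty ∨ Ap.Nonempty)
    (hB : Bm.Nonempty ∨ Bp.Nonempty) (hle : Am.card ≤ Bm.card) : False := by
  have hcm : Am.card + Bm.card = J.card := by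
    rw [← card_union_of_disjoint hdA, ← card_neg J, ← card_vadd_finset c (-J)]
    congr 1
    ext x
    rw [hm, mem_vadd_finset_iff_sub, Finset.mem_neg', neg_sub]
  have hcp : Ap.card + Bp.card = J.card := by
    rw [← card_union_of_disjoint hdB, ← card_vadd_finset c J]
    congr 1
    ext x
    rw [hp, mem_vadd_finset_iff_sub]
  have hc : ∀ x ∈ Am ∪ Bm, x ≠ c := by
    rintro x hx rfl
    rw [hm, sub_self] at hx
    exact hJ.zero_notMem hx
  have hc' : ∀ x ∈ Ap ∪ Bp, x ≠ c := by
    rintro x hx rfl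
    rw [hp, sub_self] at hx
    exact hJ.zero_notMem hx
  have d1 : Dom J (insert c Am) Bp := by
    intro u hu w hw
    rcases mem_insert.1 hu with rfl | hu
    · exact (hp w).1 (mem_union_right _ hw)
    · exact hAB u hu w hw
  have d2 : Dom J (insert c Bm) Ap := by
    intro u hu w hw
    rcases mem_insert.1 hu with rfl | hu
    · exact (hp w).1 (mem_union_left _ hw)
    · exact hBA u hu w hw
  have d3 : Dom J Am (insert c Bp) := by
    intro u hu w hw
    rcases mem_insert.1 hw with rfl | hw
    · exact (hm u).1 (mem_union_left _ hu)
    · exact hAB u hu w hw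
  have d4 : Dom J Bm (insert c Ap) := by
    intro u hu w hw
    rcases mem_insert.1 hw with rfl | hw
    · exact (hm u).1 (mem_union_right _ hu)
    · exact hBA u hu w hw
  have i1 : (insert c Am).card = Am.card + 1 :=
    card_insert_of_notMem fun h => hc c (mem_union_left _ h) rfl
  have i2 : (insert c Bm).card = Bm.card + 1 :=
    card_insert_of_notMem fun h => hc c (mem_union_right _ h) rfl
  have i3 : (insert c Bp).card = Bp.card + 1 :=
    card_insert_of_notMem fun h => hc' c (mem_union_right _ h) rfl
  have i4 : (insert c Ap).card = Ap.card + 1 :=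
    card_insert_of_notMem fun h => hc' c (mem_union_left _ h) rfl
  have b1 : Bp.Nonempty → Am.card + 1 + Bp.card ≤ J.card + 1 := fun h => by
    have := hb _ _ (insert_nonempty c Am) h d1
    omega
  have b2 : Ap.Nonempty → Bm.card + 1 + Ap.card ≤ J.card + 1 := fun h => by
    have := hb _ _ (insert_nonempty c Bm) h d2
    omega
  have b3 : Am.Nonempty → Am.card + Bp.card + 1 ≤ J.card + 1 := fun h => by
    have := hb _ _ h (insert_nonempty c Bp) d3
    omega
  have b4 : Bm.Nonempty → Bm.card + Ap.card + 1 ≤ J.card + 1 := fun h => by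
    have := hb _ _ h (insert_nonempty c Ap) d4
    omega
  simp only [← card_pos] at hA hB b1 b2 b3 b4
  have hAm : 0 < Am.card := by omega
  have hBp : 0 < Bp.card := by omega
  have hBm : 0 < Bm.card := by omega
  have hAp : 0 < Ap.card := by omega
  -- Since |Am| + |Bm| = |Ap| + |Bp| = |J|, the bounds `b1` and `b2` add up to an equality, so both
  -- are tight. The vertex `c` may join either side of the pair, and `hle` gives 2|Am| ≤ |J|.
  obtain ⟨U, W, hE, hU⟩ : ∃ U W : Finset G, IsExtremal J U W ∧ U.card = 2 := by
    by_cases h1 : Am.card = 1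
    · exact ⟨insert c Am, Bp, ⟨insert_nonempty _ _, card_pos.1 hBp, d1, by omega⟩, by omega⟩
    · exact IsExtremal.exists_card_two hJ hb (U₀ := Am) (W₀ := insert c Bp)
        ⟨card_pos.1 hAm, insert_nonempty _ _, d3, by omega⟩ (by omega) (Or.inr (by omega))
  obtain ⟨e, heJ, he⟩ := hE.exists_add_notMem hJ hb hU
  have hce : c + e ∈ Ap ∪ Bp := by
    rw [hp]
    simpa using heJ
  -- The out-neighbour `c + e` of `c` dominates all in-neighbours of `c`, against `hAB` or `hBA`.
  have hout : ∀ x ∈ Am ∪ Bm, x - (c + e) ∈ J := by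
    intro x hx
    have := he _ ((hm x).1 hx)
    convert this using 1
    abel
  rcases mem_union.1 hce with h | h
  · obtain ⟨y, hy⟩ := card_pos.1 hBm
    exact hJ.not_sub_mem (hout y (mem_union_right _ hy)) (hBA y hy _ h)
  · obtain ⟨y, hy⟩ := card_pos.1 hAm
    exact hJ.not_sub_mem (hout y (mem_union_left _ hy)) (hAB y hy _ h)

/-- Were `c` alone in its class, an in-neighbour of `c` in one remaining class would dominate every
out-neighbour of `c` in the other, which is the configuration of `false_of_singular_aux`. -/
theorem IsRainbowFree.two_le_card_filter (hJ : IsTournamentSet J) (hb : DomBound J)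
    {col : G → Fin 3} (hc : IsRainbowFree J col) (k : Fin 3) :
    2 ≤ (univ.filter fun x => col x = k).card := by
  by_contra hlt
  obtain ⟨c, hck⟩ := hc.surjective k
  have huniq : ∀ x, col x = k → x = c := by
    intro x hx
    exact card_le_one.1 (Nat.lt_succ_iff.1 (not_le.1 hlt)) x (by simpa using hx) c
      (by simpa using hck)
  obtain ⟨i, j, hij, hik, hjk⟩ : ∃ i j : Fin 3, i ≠ j ∧ i ≠ k ∧ j ≠ k := by
    clear * -
    revert k
    decide
  have hcolc : ∀ x, x ≠ c → col x = i ∨ col x = j := by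
    intro x hx
    have : col x ≠ k := fun h => hx (huniq x h)
    omega
  obtain ⟨a, ha⟩ := hc.surjective i
  obtain ⟨b, hb'⟩ := hc.surjective j
  let M : Fin 3 → Finset G := fun l => univ.filter fun x => col x = l ∧ c - x ∈ J
  let P : Fin 3 → Finset G := fun l => univ.filter fun x => col x = l ∧ x - c ∈ J
  have hM : ∀ l x, x ∈ M l ↔ col x = l ∧ c - x ∈ J := by simp [M]
  have hP : ∀ l x, x ∈ P l ↔ col x = l ∧ x - c ∈ J := by simp [P]
  have hdM : ∀ l l', l ≠ l' → Disjoint (M l) (M l') := by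
    intro l l' hl
    rw [Finset.disjoint_left]
    intro x hx hx'
    exact hl (((hM _ _).1 hx).1.symm.trans ((hM _ _).1 hx').1)
  have hdP : ∀ l l', l ≠ l' → Disjoint (P l) (P l') := by
    intro l l' hl
    rw [Finset.disjoint_left]
    intro x hx hx'
    exact hl (((hP _ _).1 hx).1.symm.trans ((hP _ _).1 hx').1)
  have hm : ∀ x, x ∈ M i ∪ M j ↔ c - x ∈ J := by
    intro x
    rw [mem_union, hM, hM, ← or_and_right]
    refine ⟨fun h => h.2, fun h => ⟨hcolc x ?_, h⟩⟩
    rintro rfl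
    rw [sub_self] at h
    exact hJ.zero_notMem h
  have hp : ∀ x, x ∈ P i ∪ P j ↔ x - c ∈ J := by
    intro x
    rw [mem_union, hP, hP, ← or_and_right]
    refine ⟨fun h => h.2, fun h => ⟨hcolc x ?_, h⟩⟩
    rintro rfl
    rw [sub_self] at h
    exact hJ.zero_notMem h
  have hdom : ∀ l l', l ≠ l' → l ≠ k → l' ≠ k → Dom J (M l) (P l') := by
    intro l l' hll hl hl' u hu w hw
    rw [hM] at hu
    rw [hP] at hw
    exact hc.trans hJ (by rw [hu.1, hck]; exact hl) (by rw [hw.1, hck]; exact hl'.symm)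
      (by rw [hu.1, hw.1]; exact hll.symm) hu.2 hw.2
  have hne : ∀ l, l ≠ k → ∀ x, col x = l → (M l).Nonempty ∨ (P l).Nonempty := by
    intro l hl x hx
    rcases hJ.sub_mem_or (x := x) (y := c) (by rintro rfl; exact hl (hx ▸ hck)) with h | h
    · exact Or.inl ⟨x, (hM _ _).2 ⟨hx, h⟩⟩
    · exact Or.inr ⟨x, (hP _ _).2 ⟨hx, h⟩⟩
  rcases le_total (M i).card (M j).card with h | h
  · exact false_of_singular_aux hJ hb (hdM i j hij) (hdP i j hij) hm hp (hdom i j hij hik hjk)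
      (hdom j i hij.symm hjk hik) (hne i hik a ha) (hne j hjk b hb') h
  · exact false_of_singular_aux hJ hb (hdM j i hij.symm) (hdP j i hij.symm)
      (by simpa only [union_comm] using hm) (by simpa only [union_comm] using hp)
      (hdom j i hij.symm hjk hik) (hdom i j hij hik hjk) (hne j hjk b hb') (hne i hik a ha) h

/-- A minimal set closed under the external in-arcs of a rainbow free colouring misses a colour. -/
theorem IsRainbowFree.exists_initial (hJ : IsTournamentSet J) {col : G → Fin 3}
    (hc : IsRainbowFree J col) {S₀ : Finset G} (hS₀ : S₀.Nonempty) :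
    ∃ L ⊆ S₀, L.Nonempty ∧
      (∀ y ∈ L, ∀ x ∈ S₀, col x ≠ col y → y - x ∈ J → x ∈ L) ∧ ∃ k, ∀ x ∈ L, col x ≠ k := by
  classical
  let F : Finset (Finset G) := S₀.powerset.filter fun L => L.Nonempty ∧
    ∀ y ∈ L, ∀ x ∈ S₀, col x ≠ col y → y - x ∈ J → x ∈ L
  have hF : ∀ L, L ∈ F ↔ L ⊆ S₀ ∧ L.Nonempty ∧
      ∀ y ∈ L, ∀ x ∈ S₀, col x ≠ col y → y - x ∈ J → x ∈ L := by
    intro L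
    simp only [F, mem_filter, mem_powerset]
  obtain ⟨L, hLF, hmin⟩ := F.exists_min_image card
    ⟨S₀, (hF _).2 ⟨Subset.refl _, hS₀, fun _ _ x hx _ _ => hx⟩⟩
  obtain ⟨hLS, hL, hin⟩ := (hF _).1 hLF
  refine ⟨L, hLS, hL, hin, ?_⟩
  by_contra! hall
  have hpath : ∃ x ∈ L, ∃ y ∈ L, ∃ z ∈ L, col x ≠ col y ∧ col y ≠ col z ∧ col z ≠ col x ∧
      y - x ∈ J ∧ z - y ∈ J := by
    obtain ⟨p, hp, hp0⟩ := hall 0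
    obtain ⟨q, hq, hq1⟩ := hall 1
    obtain ⟨r, hr, hr2⟩ := hall 2
    have hpq : p ≠ q := by rintro rfl; omega
    have hpr : p ≠ r := by rintro rfl; omega
    have hqr : q ≠ r := by rintro rfl; omega
    rcases hJ.sub_mem_or hpq with h1 | h1 <;> rcases hJ.sub_mem_or hqr with h2 | h2
    · exact ⟨p, hp, q, hq, r, hr, by omega, by omega, by omega, h1, h2⟩
    · rcases hJ.sub_mem_or hpr with h3 | h3
      · exact ⟨p, hp, r, hr, q, hq, by omega, by omega, by omega, h3, h2⟩
      · exact ⟨r, hr, p, hp, q, hq, by omega, by omega, by omega, h3, h1⟩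
    · rcases hJ.sub_mem_or hpr with h3 | h3
      · exact ⟨q, hq, p, hp, r, hr, by omega, by omega, by omega, h1, h3⟩
      · exact ⟨q, hq, r, hr, p, hp, by omega, by omega, by omega, h2, h3⟩
    · exact ⟨r, hr, q, hq, p, hp, by omega, by omega, by omega, h2, h1⟩
  obtain ⟨x, hx, y, hy, z, hz, hxy, hyz, hzx, h1, h2⟩ := hpath
  let Good : G → G → Prop := fun y z => y ∈ L ∧ z ∈ L ∧ col x ≠ col y ∧ col y ≠ col z ∧
    col z ≠ col x ∧ y - x ∈ J ∧ z - y ∈ J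
  -- Within `L`, this set is closed under out-arcs between colours (`hT`), contains `z` and misses
  -- `x`. Removing it leaves a smaller closed set, contrary to minimality.
  let T : G → Prop := fun w => (∃ y, Good y w) ∨
    (col w = col x ∧ w ≠ x ∧ ∃ y z, Good y z ∧ w - z ∈ J)
  have hT : ∀ w, T w → ∀ w' ∈ L, col w ≠ col w' → w' - w ∈ J → T w' := by
    rintro w (⟨y, hyL, hwL, hxy, hyw, hwx, h1, h2⟩ |
      ⟨hwx, hne, y, z, ⟨hyL, hzL, hxy, hyz, hzx, h1, h2⟩, h3⟩) w' hw' hcol h4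
    · have hxw : w - x ∈ J := hc.trans hJ hxy hyw hwx h1 h2
      by_cases hw'x : col w' = col x
      · right
        refine ⟨hw'x, ?_, y, w, ⟨hyL, hwL, hxy, hyw, hwx, h1, h2⟩, h4⟩
        rintro rfl
        exact hJ.not_sub_mem hxw h4
      · left
        exact ⟨w, hwL, hw', hwx.symm, hcol, hw'x, hxw, h4⟩
    · have hxz : z - x ∈ J := hc.trans hJ hxy hyz hzx h1 h2
      have hyw : w - y ∈ J := hc.trans hJ hyz (by omega) (by omega) h2 h3
      by_cases hw'y : col w' = col y
      · have : w' - z ∈ J := hc.trans hJ (v := w) (by omega) hcol (by omega) h3 h4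
        exact Or.inl ⟨z, hzL, hw', hzx.symm, by omega, by omega, hxz, this⟩
      · have : w' - y ∈ J := hc.trans hJ (v := w) (by omega) hcol hw'y hyw h4
        exact Or.inl ⟨y, hyL, hw', hxy, Ne.symm hw'y, by omega, h1, this⟩
  have hxT : ¬ T x := by
    rintro (⟨y, _, _, _, _, h, _⟩ | ⟨_, h, _⟩)
    · exact h rfl
    · exact h rfl
  have hzT : T z := Or.inl ⟨y, hy, hz, hxy, hyz, hzx, h1, h2⟩
  have hL' : (L.filter fun w => ¬ T w) ∈ F := by
    refine (hF _).2 ⟨(filter_subset _ _).trans hLS, ⟨x, mem_filter.2 ⟨hx, hxT⟩⟩, ?_⟩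
    intro v hv u hu hne huv
    rw [mem_filter] at hv ⊢
    exact ⟨hin v hv.1 u hu hne huv, fun hTu => hv.2 (hT u hTu v hv.1 hne huv)⟩
  have hlt : (L.filter fun w => ¬ T w).card < L.card :=
    card_lt_card (filter_ssubset.2 ⟨z, hz, fun h => h hzT⟩)
  have := hmin _ hL'
  omega

/-- A closed set missing the colour `k` and meeting both other colours forces the class of `k` to be
singular. Here `D` is a set of vertices of colour `j` dominating the other classes. -/
theorem IsRainbowFree.false_of_initial (hJ : IsTournamentSet J) (hb : DomBound J)
    {col : G → Fin 3} (hc : IsRainbowFree J col) {i j k : Fin 3} (hij : i ≠ j) (hik : i ≠ k)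
    (hjk : j ≠ k) {D L : Finset G} (hD : ∀ b ∈ D, col b = j ∧ ∀ x, col x ≠ j → x - b ∈ J)
    (hL : ∀ y ∈ L, ∀ x, x ∉ D → col x ≠ col y → y - x ∈ J → x ∈ L) (hk : ∀ x ∈ L, col x ≠ k)
    (hi : ∃ x ∈ L, col x = i) (hj : ∃ x ∈ L ∪ D, col x = j) : False := by
  classical
  have hout : ∀ x ∈ L, ∀ y, y ∉ L → y ∉ D → col x ≠ col y → y - x ∈ J := by
    intro x hx y hyL hyD hne
    refine (hJ.sub_mem_or (x := x) (y := y) (fun h => hne (h ▸ rfl))).resolve_right fun h => ?_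
    exact hyL (hL x hx y hyD hne.symm h)
  set A := univ.filter fun x => col x = i with hA
  set B := univ.filter fun x => col x = j with hB
  set C := univ.filter fun x => col x = k with hC
  have hcard : A.card + B.card + C.card = Fintype.card G := card_filter_add_three col hij hik hjk
  have hmA : ∀ x, x ∈ A ↔ col x = i := by simp [hA]
  have hmB : ∀ x, x ∈ B ↔ col x = j := by simp [hB]
  have hmC : ∀ x, x ∈ C ↔ col x = k := by simp [hC]
  have hC2 : 2 ≤ C.card := hc.two_le_card_filter hJ hb k
  have hCne : C.Nonempty := card_pos.1 (by omega)
  have hd1 : Dom J (A ∩ L) ((B \ (L ∪ D)) ∪ C) := by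
    intro u hu w hw
    simp only [mem_inter, mem_union, mem_sdiff, hmA, hmB, hmC] at hu hw
    rcases hw with ⟨hw, hw'⟩ | hw
    · exact hout u hu.2 w (fun h => hw' (Or.inl h)) (fun h => hw' (Or.inr h)) (by omega)
    · exact hout u hu.2 w (fun h => hk w h hw) (fun h => hjk ((hD w h).1.symm.trans hw)) (by omega)
  have hd2 : Dom J (B ∩ (L ∪ D)) ((A \ L) ∪ C) := by
    intro u hu w hw
    simp only [mem_inter, mem_union, mem_sdiff, hmA, hmB, hmC] at hu hw
    have hwj : col w ≠ j := by omega
    have hwL : w ∉ L := by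
      rcases hw with hw | hw
      · exact hw.2
      · exact fun h => hk w h hw
    rcases hu with ⟨hu, hu' | hu'⟩
    · exact hout u hu' w hwL (fun h => hwj (hD w h).1) (by omega)
    · exact (hD u hu').2 w hwj
  have hne1 : (A ∩ L).Nonempty := by
    obtain ⟨x, hx, hxi⟩ := hi
    exact ⟨x, mem_inter.2 ⟨(hmA x).2 hxi, hx⟩⟩
  have hne2 : (B ∩ (L ∪ D)).Nonempty := by
    obtain ⟨x, hx, hxj⟩ := hj
    exact ⟨x, mem_inter.2 ⟨(hmB x).2 hxj, hx⟩⟩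
  -- The two bounds add up to |A| + |B| + 2|C| ≤ 2|J| + 2 = |G| + 1, so |C| ≤ 1.
  have h1 := hb _ _ hne1 (hCne.mono subset_union_right) hd1
  have h2 := hb _ _ hne2 (hCne.mono subset_union_right) hd2
  rw [card_union_of_disjoint] at h1 h2
  · have h3 := card_inter_add_card_sdiff A L
    have h4 := card_inter_add_card_sdiff B (L ∪ D)
    rw [hJ.card_eq] at hcard
    omega
  · rw [Finset.disjoint_left]
    intro x hx hx'
    rw [mem_sdiff, hmA] at hx
    rw [hmC] at hx'
    omega
  · rw [Finset.disjoint_left]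
    intro x hx hx'
    rw [mem_sdiff, hmB] at hx
    rw [hmC] at hx'
    omega

/-- The domination bound excludes rainbow free colourings with three colours. -/
theorem not_isRainbowFree (hJ : IsTournamentSet J) (hb : DomBound J) (col : G → Fin 3) :
    ¬ IsRainbowFree J col := by
  classical
  intro hc
  have hthird : ∀ i j : Fin 3, i ≠ j → ∃ k, i ≠ k ∧ j ≠ k := by decide
  -- some vertex dominates all the vertices of the other colours
  obtain ⟨j, b₀, hb₀, hb₀'⟩ : ∃ j b, col b = j ∧ ∀ x, col x ≠ j → x - b ∈ J := by
    obtain ⟨L, -, ⟨b, hbL⟩, hin, k, hk⟩ := hc.exists_initial hJ ⟨0, mem_univ (0 : G)⟩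
    obtain ⟨i, hi1, hi2⟩ := hthird k (col b) (hk b hbL).symm
    refine ⟨col b, b, rfl, fun x hx => ?_⟩
    refine (hJ.sub_mem_or (x := b) (y := x) (fun h => hx (h ▸ rfl))).resolve_right fun h => ?_
    have hxL := hin b hbL x (mem_univ _) hx h
    have hxk := hk x hxL
    exact hc.false_of_initial hJ hb (i := col b) (j := col x) (k := k) hx.symm (hk b hbL) hxk
      (D := ∅) (L := L) (by simp) (fun y hy x _ => hin y hy x (mem_univ _)) hk ⟨b, hbL, rfl⟩
      ⟨x, by simpa using hxL, rfl⟩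
  set D := univ.filter fun b => col b = j ∧ ∀ x, col x ≠ j → x - b ∈ J with hDdef
  have hD : ∀ b, b ∈ D ↔ col b = j ∧ ∀ x, col x ≠ j → x - b ∈ J := by simp [hDdef]
  have hb₀D : b₀ ∈ D := (hD _).2 ⟨hb₀, hb₀'⟩
  have hS₀ : (univ \ D).Nonempty := by
    obtain ⟨i, hi⟩ : ∃ i : Fin 3, i ≠ j := by
      clear * -
      revert j
      decide
    obtain ⟨x, hx⟩ := hc.surjective i
    refine ⟨x, mem_sdiff.2 ⟨mem_univ _, fun h => ?_⟩⟩
    exact hi (hx.symm.trans ((hD x).1 h).1)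
  obtain ⟨L, hLS, ⟨v, hv⟩, hin, k, hk⟩ := hc.exists_initial hJ hS₀
  have hin' : ∀ y ∈ L, ∀ x, x ∉ D → col x ≠ col y → y - x ∈ J → x ∈ L :=
    fun y hy x hx => hin y hy x (mem_sdiff.2 ⟨mem_univ _, hx⟩)
  have hj : ∃ x ∈ L ∪ D, col x = j := ⟨b₀, mem_union_right _ hb₀D, hb₀⟩
  have hLD : ∀ x ∈ L, x ∉ D := fun x hx => (mem_sdiff.1 (hLS hx)).2
  have hout : ∀ x ∈ L, ∀ y, y ∉ L → y ∉ D → col x ≠ col y → y - x ∈ J := by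
    intro x hx y hyL hyD hne
    refine (hJ.sub_mem_or (x := x) (y := y) (fun h => hne (h ▸ rfl))).resolve_right fun h => ?_
    exact hyL (hin' x hx y hyD hne.symm h)
  by_cases hkj : k = j
  · subst hkj
    obtain ⟨i, hi1, hi2⟩ := hthird k (col v) (hk v hv).symm
    by_cases hi : ∃ w ∈ L, col w = i
    · obtain ⟨w, hw, hwi⟩ := hi
      set B := univ.filter fun x => col x = k with hB
      have hmB : ∀ x, x ∈ B ↔ col x = k := by simp [hB]
      have hDB : D ⊆ B := fun x hx => (hmB x).2 ((hD x).1 hx).1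
      have hvB : v ∈ univ \ B := by simpa [hmB] using hk v hv
      have hwB : w ∈ univ \ B := by simpa [hmB] using hk w hw
      have hd1 : Dom J D (univ \ B) := by
        intro u hu x hx
        exact ((hD u).1 hu).2 x (by simpa [hmB] using hx)
      have hd2 : Dom J L (B \ D) := by
        intro u hu x hx
        rw [mem_sdiff, hmB] at hx
        exact hout u hu x (fun h => hk x h hx.1) hx.2 (by rw [hx.1]; exact hk u hu)
      -- Together with `h4` this gives |G| + |L| ≤ 2|J| + 2, so |L| ≤ 1, although `L` contains `v`
      -- and `w`.
      have h1 := hb _ _ ⟨b₀, hb₀D⟩ ⟨v, hvB⟩ hd1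
      have h2 := card_sdiff_add_card_eq_card (subset_univ B)
      have h3 := card_sdiff_add_card_eq_card hDB
      rw [card_univ, hJ.card_eq] at h2
      have hvw : 1 < L.card := one_lt_card.2 ⟨v, hv, w, hw, by rintro rfl; omega⟩
      have hvw' : 1 < (univ \ B).card := one_lt_card.2 ⟨v, hvB, w, hwB, by rintro rfl; omega⟩
      have hB2 : 2 ≤ B.card := hc.two_le_card_filter hJ hb k
      have h4 := hb _ _ ⟨v, hv⟩ (card_pos.1 (by omega)) hd2
      omega
    · push Not at hi
      exact hc.false_of_initial hJ hb (i := col v) (j := k) (k := i) (hk v hv) hi2 hi1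
        (fun b hb => (hD b).1 hb) hin' hi ⟨v, hv, rfl⟩ hj
  · obtain ⟨i, hi1, hi2⟩ := hthird k j hkj
    by_cases hi : ∃ w ∈ L, col w = i
    · exact hc.false_of_initial hJ hb (i := i) (j := j) (k := k) hi2.symm hi1.symm (Ne.symm hkj)
        (fun b hb => (hD b).1 hb) hin' hk hi hj
    · push Not at hi
      have hLj : ∀ x ∈ L, col x = j := by
        intro x hx
        have h1 := hi x hx
        have h2 := hk x hx
        omega
      refine hLD v hv ((hD v).2 ⟨hLj v hv, fun x hx => ?_⟩)
      exact hout v hv x (fun h => hx (hLj x h)) (fun h => hx ((hD x).1 h).1)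
        (by rw [hLj v hv]; exact hx.symm)

end Colorings

/-! ### From colourings to compositions, `omega3` and keenness. -/

section Cayley

open Finset

variable {G : Type*} [AddCommGroup G] {J : Finset G}

/-- The Cayley digraph of an additive group, with an arc from `x` to `y` if `y - x ∈ J`. -/
def cayleyDigraph {G : Type*} [AddCommGroup G] (J : Finset G) : Digraph G where
  Adj x y := y - x ∈ J

/-- The two-class partition with singular class `{0}`. -/
def zeroSetoid (G : Type*) [Zero G] : Setoid G := Setoid.ker fun x : G => x = 0

theorem zeroSetoid_apply {x y : G} : zeroSetoid G x y ↔ (x = 0 ↔ y = 0) := by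
  rw [zeroSetoid, Setoid.ker_def, eq_iff_iff]

theorem zeroSetoid_isExternallyTriangleFree (D : Digraph G) :
    D.IsExternallyTriangleFree (zeroSetoid G) := by
  rintro ⟨u, v, w, -, -, -, ⟨-, h1⟩, ⟨-, h2⟩, ⟨-, h3⟩⟩
  rw [zeroSetoid_apply] at h1 h2 h3
  tauto

theorem zeroSetoid_classes [Nontrivial G] : (zeroSetoid G).classes = {{0}, {0}ᶜ} := by
  obtain ⟨g, hg⟩ := exists_ne (0 : G)
  ext s
  simp only [Setoid.classes, Set.mem_ofPred_eq, Set.mem_insert_iff, Set.mem_singleton_iff,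
    zeroSetoid_apply]
  constructor
  · rintro ⟨y, rfl⟩
    by_cases hy : y = 0
    · left
      ext x
      simp [hy]
    · right
      ext x
      simp [hy]
  · rintro (rfl | rfl)
    · exact ⟨0, by ext x; simp⟩
    · exact ⟨g, by ext x; simp [hg]⟩

/-- A Cayley tournament that violates the domination bound is a nontrivial composition. -/
theorem domBound_of_isSimple [Fintype G] (hJ : IsTournamentSet J)
    (hs : (cayleyDigraph J).IsSimple) : DomBound J := by
  classical
  by_contra hb
  obtain ⟨H, hbot, htop, hH⟩ := exists_addSubgroup_of_not_domBound hJ hb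
  -- The choice of representatives is harmless: by `hH`, `J` outside `H` is a union of cosets.
  let E : Digraph (G ⧸ H) := ⟨fun p q => p ≠ q ∧ q.out - p.out ∈ J⟩
  let F : Digraph H := ⟨fun a b => (b : G) - a ∈ J⟩
  have hout : ∀ g : G, g - (g : G ⧸ H).out ∈ H := by
    intro g
    rw [← neg_add_eq_sub, ← QuotientAddGroup.eq, QuotientAddGroup.out_eq']
  let e : G ≃ (G ⧸ H) × H :=
    { toFun := fun g => ((g : G ⧸ H), ⟨g - (g : G ⧸ H).out, hout g⟩)
      invFun := fun p => p.1.out + p.2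
      left_inv := fun g => by simp
      right_inv := by
        rintro ⟨q, h⟩
        have hq : ((q.out + (h : G) : G) : G ⧸ H) = q := by
          rw [QuotientAddGroup.mk_add_of_mem _ h.2, QuotientAddGroup.out_eq']
        ext
        · exact hq
        · simp [hq] }
  refine (hs (G ⧸ H) H E F (QuotientAddGroup.nontrivial_iff.2 htop)
    ((AddSubgroup.nontrivial_iff_ne_bot H).2 hbot)).false ⟨e, ?_⟩
  intro a b
  change ((a : G ⧸ H) ≠ (b : G ⧸ H) ∧ (b : G ⧸ H).out - (a : G ⧸ H).out ∈ J) ∨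
    ((a : G ⧸ H) = (b : G ⧸ H) ∧ (b - (b : G ⧸ H).out) - (a - (a : G ⧸ H).out) ∈ J) ↔ b - a ∈ J
  by_cases hab : (a : G ⧸ H) = b
  · simp [hab]
  · have hba : b - a ∉ H := by
      rwa [← neg_add_eq_sub, ← QuotientAddGroup.eq]
    have hk := H.sub_mem (hout b) (hout a)
    simp only [hab, ne_eq, not_false_eq_true, true_and, false_and, or_false]
    constructor
    · intro h
      have h1 := hH _ h (fun hmem => hba (by
        have := H.add_mem hmem hk
        convert this using 1
        abel)) _ hk
      convert h1 using 1
      abel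
    · intro h
      have h1 := hH _ h hba _ (H.neg_mem hk)
      convert h1 using 1
      abel

/-- Three components would give a 3-colouring constant on components. Arcs between colours then lie
in `H`, so a rainbow triangle would be a triangle of `H`. -/
theorem card_connectedComponent_le_two [Fintype G] (hJ : IsTournamentSet J) (hb : DomBound J)
    {H : Digraph G} (hH : H.IsTriangleFree) :
    Nat.card (cayleyDigraph J \ H).toSimpleGraphInclusive.ConnectedComponent ≤ 2 := by
  classical
  set Γ := (cayleyDigraph J \ H).toSimpleGraphInclusive with hΓ
  by_contra hlt
  rw [Nat.card_eq_fintype_card, not_le, Fintype.two_lt_card_iff] at hlt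
  obtain ⟨c₀, c₁, c₂, h01, h02, h12⟩ := hlt
  let f : Γ.ConnectedComponent → Fin 3 := fun c => if c = c₀ then 0 else if c = c₁ then 1 else 2
  refine not_isRainbowFree hJ hb (fun v => f (Γ.connectedComponentMk v)) ⟨?_, ?_⟩
  · have hf : Function.Surjective f := by
      intro i
      fin_cases i
      · exact ⟨c₀, by simp [f]⟩
      · exact ⟨c₁, by simp [f, h01.symm]⟩
      · exact ⟨c₂, by simp [f, h02.symm, h12.symm]⟩
    exact hf.comp Quot.mk_surjective
  · have harc : ∀ u v, f (Γ.connectedComponentMk u) ≠ f (Γ.connectedComponentMk v) →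
        v - u ∈ J → H.Adj u v := by
      intro u v hne huv
      by_contra hnot
      apply hne
      congr 1
      refine SimpleGraph.ConnectedComponent.eq.2 (SimpleGraph.Adj.reachable ?_)
      exact ⟨fun h => hne (h ▸ rfl), Or.inl ⟨huv, hnot⟩⟩
    intro u v w huv hvw hwu h1 h2 h3
    exact hH ⟨u, v, w, fun h => huv (h ▸ rfl), fun h => hvw (h ▸ rfl), fun h => hwu (h ▸ rfl),
      harc u v huv h1, harc v w hvw h2, harc w u hwu h3⟩

theorem omega3_cayleyDigraph [Fintype G] [Nontrivial G] (hJ : IsTournamentSet J)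
    (hb : DomBound J) : (cayleyDigraph J).omega3 = 2 := by
  classical
  apply IsGreatest.csSup_eq
  refine ⟨⟨(cayleyDigraph J).externalArcs (zeroSetoid G), fun u v h => h.1,
    zeroSetoid_isExternallyTriangleFree _, ?_⟩, ?_⟩
  · refine le_antisymm ?_ (card_connectedComponent_le_two hJ hb
      (zeroSetoid_isExternallyTriangleFree _))
    set Γ := (cayleyDigraph J \ (cayleyDigraph J).externalArcs
      (zeroSetoid G)).toSimpleGraphInclusive
    have hadj : ∀ u v, Γ.Adj u v → (u = 0 ↔ v = 0) := by
      rintro u v ⟨-, h | h⟩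
      · exact zeroSetoid_apply.1 (not_not.1 fun hn => h.2 ⟨h.1, hn⟩)
      · exact (zeroSetoid_apply.1 (not_not.1 fun hn => h.2 ⟨h.1, hn⟩)).symm
    have hreach : ∀ u v, Γ.Reachable u v → (u = 0 ↔ v = 0) := by
      rintro u v ⟨p⟩
      induction p with
      | nil => rfl
      | cons h _ ih => exact (hadj _ _ h).trans ih
    obtain ⟨g, hg⟩ := exists_ne (0 : G)
    rw [Nat.card_eq_fintype_card]
    refine Fintype.one_lt_card_iff.2 ⟨Γ.connectedComponentMk 0, Γ.connectedComponentMk g, ?_⟩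
    intro h
    exact hg ((hreach _ _ (SimpleGraph.ConnectedComponent.eq.1 h)).1 rfl)
  · rintro k ⟨H, -, hH, rfl⟩
    exact card_connectedComponent_le_two hJ hb hH

/-- Every arc of a Cayley tournament lies in a directed triangle. -/
theorem IsTournamentSet.exists_triangle (hJ : IsTournamentSet J) {u v : G} (huv : v - u ∈ J) :
    ∃ w, w - v ∈ J ∧ u - w ∈ J := by
  classical
  by_contra! hall
  -- Without such a triangle, every out-neighbour of `v` would be an out-neighbour of `u` other than
  -- `v`, so `u` would have at least |J| + 1 of them. The 0 added on both sides keeps the inclusion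
  -- true when `v - u + j = 0`.
  have hsub : insert 0 (J.map (addLeftEmbedding (v - u))) ⊆ insert 0 (J.erase (v - u)) := by
    intro x hx
    rcases mem_insert.1 hx with rfl | hx
    · exact mem_insert_self _ _
    · obtain ⟨j, hj, rfl⟩ := mem_map.1 hx
      rw [addLeftEmbedding_apply]
      have h1 := hall (v + j) (by simpa using hj)
      by_cases h0 : v - u + j = 0
      · rw [h0]
        exact mem_insert_self _ _
      · refine mem_insert_of_mem (mem_erase.2 ⟨?_, ?_⟩)
        · intro h
          rw [add_eq_left] at h
          exact hJ.zero_notMem (h ▸ hj)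
        · refine hJ.mem_of_neg_notMem _ h0 ?_
          convert h1 using 2
          abel
  have h0 : (0 : G) ∉ J.map (addLeftEmbedding (v - u)) := by
    intro h
    obtain ⟨j, hj, h⟩ := mem_map.1 h
    rw [addLeftEmbedding_apply] at h
    rw [← neg_eq_of_add_eq_zero_right h] at hj
    exact hJ.neg_notMem _ huv hj
  have h1 := card_le_card hsub
  rw [card_insert_of_notMem h0, card_map, card_insert_of_notMem (fun h =>
    hJ.zero_notMem (mem_of_mem_erase h)), card_erase_of_mem huv] at h1
  have := card_pos.2 ⟨_, huv⟩
  omega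

/-- The third vertex of a triangle through two singular classes lies in a third class, so all three
arcs are external. -/
theorem ncard_singularClasses_le_one [Finite G] (hJ : IsTournamentSet J) (π : Setoid G)
    (hπ : (cayleyDigraph J).IsExternallyTriangleFree π) : π.singularClasses.ncard ≤ 1 := by
  rw [Set.ncard_le_one]
  have hsing : ∀ u, ({u} : Set G) ∈ π.classes → ∀ w, π w u ∨ π u w → w = u := by
    rintro u ⟨y, hy⟩ w hw
    have hu : π u y := by
      have : u ∈ ({u} : Set G) := rfl
      rw [hy] at this
      exact this
    have : w ∈ {x | π x y} := by
      rcases hw with hw | hw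
      · exact π.trans' hw hu
      · exact π.trans' (π.symm' hw) hu
    rw [← hy] at this
    exact this
  have key : ∀ u v, ({u} : Set G) ∈ π.classes → ({v} : Set G) ∈ π.classes → v - u ∉ J := by
    intro u v hu hv huv
    obtain ⟨w, h1, h2⟩ := hJ.exists_triangle huv
    have huv' : u ≠ v := by
      rintro rfl
      exact hJ.zero_notMem (by simpa using huv)
    have hvw : v ≠ w := by
      rintro rfl
      exact hJ.zero_notMem (by simpa using h1)
    have hwu : w ≠ u := by
      rintro rfl
      exact hJ.zero_notMem (by simpa using h2)
    exact hπ ⟨u, v, w, huv', hvw, hwu, ⟨huv, fun h => huv' (hsing v hv u (Or.inl h))⟩,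
      ⟨h1, fun h => hvw (hsing v hv w (Or.inr h)).symm⟩,
      ⟨h2, fun h => hwu (hsing u hu w (Or.inl h))⟩⟩
  rintro A ⟨hA, hA1⟩ B ⟨hB, hB1⟩
  obtain ⟨u, rfl⟩ := Set.ncard_eq_one.1 hA1
  obtain ⟨v, rfl⟩ := Set.ncard_eq_one.1 hB1
  by_contra hne
  have huv : u ≠ v := by
    rintro rfl
    exact hne rfl
  rcases hJ.sub_mem_or huv with h | h
  · exact key u v hA hB h
  · exact key v u hB hA h

theorem isOmega3Keen_cayleyDigraph [Fintype G] [Nontrivial G] (hJ : IsTournamentSet J)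
    (hs : (cayleyDigraph J).IsSimple) : (cayleyDigraph J).IsOmega3Keen := by
  have hb := domBound_of_isSimple hJ hs
  refine ⟨⟨zeroSetoid G, ⟨zeroSetoid_isExternallyTriangleFree _, ?_⟩, ?_⟩,
    ncard_singularClasses_le_one hJ⟩
  · rw [omega3_cayleyDigraph hJ hb, zeroSetoid_classes, Set.ncard_pair]
    intro h
    have : (0 : G) ∈ ({0}ᶜ : Set G) := h ▸ rfl
    exact this rfl
  · refine le_antisymm
      (ncard_singularClasses_le_one hJ _ (zeroSetoid_isExternallyTriangleFree _)) ?_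
    rw [Nat.one_le_iff_ne_zero, ← Nat.pos_iff_ne_zero, Set.ncard_pos]
    exact ⟨{0}, by rw [zeroSetoid_classes]; simp, Set.ncard_singleton 0⟩

end Cayley

/-! ### Specialisation to the integers modulo 2n + 1. -/

section Circulant

open Finset

theorem IsSymbolSet.isTournamentSet {n : ℕ} {J : Finset (ZMod (2 * n + 1))}
    (hJ : IsSymbolSet n J) : IsTournamentSet J := by
  have hneg : ∀ x ∈ J, -x ∉ J := by
    intro x hx hx'
    have hne : x ≠ -x := by
      intro h
      have h2 : (2 : ℕ) • x = 0 := by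
        rw [two_nsmul]
        nth_rewrite 2 [h]
        exact add_neg_cancel x
      have h3 : n • ((2 : ℕ) • x) + x = (2 * n + 1) • x := by
        rw [smul_smul, ← succ_nsmul, mul_comm n 2]
      have h4 : x = 0 := by simpa [h2] using h3
      exact hJ.zero_notMem (h4 ▸ hx)
    have h1 := hJ.card_pair x hx
    rw [inter_eq_left.2 (by intro y; simp only [mem_insert, mem_singleton]; rintro (rfl | rfl) <;>
      assumption), Finset.card_pair hne] at h1
    omega
  refine ⟨hJ.zero_notMem, ?_, hneg⟩
  intro x hx hxJ
  by_contra hx'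
  -- Since `J` and `-J` are disjoint, they and 0 already fill all 2n + 1 residues; `x` would be one
  -- too many.
  have hsub : insert x (insert 0 (J ∪ J.map (Equiv.neg _).toEmbedding)) ⊆ univ := subset_univ _
  have h1 := card_le_card hsub
  rw [card_insert_of_notMem, card_insert_of_notMem, card_union_of_disjoint, card_map, hJ.card_eq,
    card_univ, ZMod.card] at h1
  · omega
  · rw [Finset.disjoint_left]
    intro y hy hy'
    obtain ⟨z, hz, rfl⟩ := mem_map.1 hy'
    exact hneg z hz hy
  · simp [hJ.zero_notMem]
  · simp only [mem_insert, mem_union, mem_map_equiv, not_or]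
    exact ⟨hx, hx', by simpa using hxJ⟩

end Circulant

theorem mainTheorem11 (n : ℕ) (hn : 1 ≤ n) (J : Finset (ZMod (2 * n + 1)))
    (hJ : IsSymbolSet n J) (hsimple : (circulantTournament n J).IsSimple) :
    (circulantTournament n J).IsOmega3Keen := by
  -- This supplies `Nontrivial (ZMod (2 * n + 1))`; `circulantTournament n J` is definitionally
  -- `cayleyDigraph J`.
  have : Fact (1 < 2 * n + 1) := ⟨by omega⟩
  exact isOmega3Keen_cayleyDigraph hJ.isTournamentSet hsimple
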